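/- Let $G$ be a discrete group. A $G$-flow is a non-empty compact Hausdorff space $X$ with an action of $G$ by homeomorphisms; isomorphisms of flows are equivariant homeomorphisms, and $Y$ is a factor of $X$ if there is an equivariant continuous surjection $X \to Y$. The flow $X$ is minimal if every orbit is dense, and strongly proximal if for every regular Borel probability measure $\mu$ on $X$ there is a net $(g_i)$ in $G$ such that $g_i\mu$ converges in the weak* topology to a point mass $\delta_x$, $x \in X$. The universal minimal strongly proximal flow $\partial_F G$ is the minimal strongly proximal $G$-flow, unique up to isomorphism, of which every minimal strongly proximal $G$-flow is a factor. A subset $A \subseteq G$ is strongly completely syndetic if for every $\varepsilon > 0$ there is a finite subset $F \subseteq G$ such that for every finite multiset $K$ in $G$ there is $f \in F$ with $|fK \cap A| \ge (1-\varepsilon)|K|$, where cardinalities are counted with multiplicity. A Boolean subalgebra $\mathfrak{B}$ of the Boolean algebra $2^G$ of all subsets of $G$ is translation invariant if $gA \in \mathfrak{B}$ for all $g \in G$ and $A \in \mathfrak{B}$. Its Stone space is the set of ultrafilters on $\mathfrak{B}$, with the topology generated by the sets $\{x : A \in x\}$, $A \in \mathfrak{B}$, and the $G$-action $gx = \{gA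 : A \in x\}$. Theorem. Let $\mathfrak{B} \subseteq 2^G$ be a translation invariant Boolean subalgebra that is maximal, with respect to inclusion, among the translation invariant Boolean subalgebras of $2^G$ in which every non-empty element is strongly completely syndetic. Then the universal minimal strongly proximal flow $\partial_F G$ is isomorphic, as a $G$-flow, to the Stone space of $\mathfrak{B}$. In other words, the Stone space of $\mathfrak{B}$ is a minimal strongly proximal $G$-flow of which every minimal strongly proximal $G$-flow is a factor, and every $G$-flow with these properties is isomorphic to it. -/

import Mathlib

open MeasureTheory Filter Topology
open scoped Pointwise

universe u v w

/-! ### Flows of a discrete group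

A `G`-flow is a compact Hausdorff space `X` with an action of `G` by homeomorphisms, i.e. with
`[TopologicalSpace X] [CompactSpace X] [T2Space X] [MulAction G X] [ContinuousConstSMul G X]`. -/

/-- The push-forward `g μ` of a Borel probability measure under the action of `g`. -/
noncomputable def translateMeasure {G : Type u} {X : Type v} [Group G] [TopologicalSpace X]
    [MulAction G X] [ContinuousConstSMul G X] [MeasurableSpace X] [BorelSpace X]
    (g : G) (μ : ProbabilityMeasure X) : ProbabilityMeasure X :=
  μ.map (f := fun x => g • x) (continuous_const_smul g).measurable.aemeasurable

/-- The Dirac measure at `x`, as a probability measure. -/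
noncomputable def pointMass {X : Type v} [MeasurableSpace X] (x : X) : ProbabilityMeasure X :=
  ⟨Measure.dirac x, inferInstance⟩

/-- `X` is strongly proximal: for every regular Borel probability measure `μ` on `X` some net of
translates `gᵢ μ` converges weakly to a point mass. Nets in `G` are encoded by proper filters on
`G`. The (unique) Borel `σ`-algebra of `X` is introduced by the quantifier over
`[MeasurableSpace X] [BorelSpace X]`. -/
def IsStronglyProximal (G : Type u) (X : Type v) [Group G] [TopologicalSpace X]
    [MulAction G X] [ContinuousConstSMul G X] : Prop :=
  ∀ [MeasurableSpace X] [BorelSpace X] (μ : ProbabilityMeasure X), (μ : Measure X).Regular →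
    ∃ (x : X) (l : Filter G), l.NeBot ∧
      Tendsto (fun g => translateMeasure g μ) l (𝓝 (pointMass x))

/-- Minimal strongly proximal flows (the empty flow is excluded, as usual). -/
structure IsMinimalStronglyProximal (G : Type u) (X : Type v) [Group G] [TopologicalSpace X]
    [MulAction G X] [ContinuousConstSMul G X] : Prop where
  nonempty : Nonempty X
  minimal : MulAction.IsMinimal G X
  stronglyProximal : IsStronglyProximal G X

/-- `Y` is a factor of `X`: there is an equivariant continuous surjection from `X` onto `Y`. -/
def IsFactor (G : Type u) (Y : Type w) (X : Type v) [Group G]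
    [TopologicalSpace X] [MulAction G X] [TopologicalSpace Y] [MulAction G Y] : Prop :=
  ∃ α : X → Y, Continuous α ∧ Function.Surjective α ∧ ∀ (g : G) (x : X), α (g • x) = g • α x

/-- `X` and `Y` are isomorphic as flows: there is an equivariant homeomorphism between them. -/
def FlowIsomorphic (G : Type u) (X : Type v) (Y : Type w) [Group G]
    [TopologicalSpace X] [MulAction G X] [TopologicalSpace Y] [MulAction G Y] : Prop :=
  ∃ e : X ≃ₜ Y, ∀ (g : G) (x : X), e (g • x) = g • e x

/-- `X` is a universal minimal strongly proximal flow (Furstenberg boundary) of `G`: it is minimal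
and strongly proximal, and every minimal strongly proximal flow (in the universe `w`) is a factor
of `X`. -/
structure IsUniversalMinimalStronglyProximal (G : Type u) (X : Type v) [Group G]
    [TopologicalSpace X] [CompactSpace X] [T2Space X] [MulAction G X]
    [ContinuousConstSMul G X] : Prop where
  isMinimalStronglyProximal : IsMinimalStronglyProximal G X
  universal : ∀ (Y : Type w) [TopologicalSpace Y] [CompactSpace Y] [T2Space Y] [MulAction G Y]
    [ContinuousConstSMul G Y], IsMinimalStronglyProximal G Y → IsFactor G Y X

/-! ### Strongly completely syndetic sets -/

open Classical in
/-- `|f K ∩ A|`, counted with multiplicity, for a finite multiset `K` in `G`. -/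
noncomputable def translateInterCard {G : Type u} [Group G] (f : G) (K : Multiset G)
    (A : Set G) : ℕ :=
  ((K.map (fun k => f * k)).filter (fun k => k ∈ A)).card

/-- `A` is strongly completely syndetic: for every `ε > 0` there is a finite `F ⊆ G` such that
every finite multiset `K` in `G` has a translate `f K`, `f ∈ F`, with
`|f K ∩ A| ≥ (1 - ε) |K|`. -/
def IsStronglyCompletelySyndetic {G : Type u} [Group G] (A : Set G) : Prop :=
  ∀ ε : ℝ, 0 < ε → ∃ F : Finset G, ∀ K : Multiset G,
    ∃ f ∈ F, (1 - ε) * (K.card : ℝ) ≤ (translateInterCard f K A : ℝ)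

/-! ### Translation invariant Boolean subalgebras of `2^G` -/

/-- A Boolean subalgebra of `2^G` is translation invariant if it is closed under left
translations. -/
class IsTranslationInvariant {G : Type u} [Group G] (B : BooleanSubalgebra (Set G)) : Prop where
  smul_mem : ∀ (g : G) {A : Set G}, A ∈ B → g • A ∈ B

/-- Left translation by `g`, on the elements of a translation invariant Boolean subalgebra. -/
def leftTranslate {G : Type u} [Group G] {B : BooleanSubalgebra (Set G)} [IsTranslationInvariant B]
    (g : G) (A : B) : B :=
  ⟨g • (A : Set G), IsTranslationInvariant.smul_mem g A.2⟩

/-! ### Stone spaces -/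

/-- The Stone space of a Boolean algebra: the set of its ultrafilters. -/
@[ext]
structure StoneSpace (α : Type u) [BooleanAlgebra α] where
  carrier : Set α
  top_mem : ⊤ ∈ carrier
  bot_notMem : ⊥ ∉ carrier
  inf_mem : ∀ {a b : α}, a ∈ carrier → b ∈ carrier → a ⊓ b ∈ carrier
  mem_of_le : ∀ {a b : α}, a ∈ carrier → a ≤ b → b ∈ carrier
  mem_or_compl_mem : ∀ a : α, a ∈ carrier ∨ aᶜ ∈ carrier

namespace StoneSpace

variable {α : Type u} [BooleanAlgebra α]

/-- The set of the ultrafilters that contain `a`. -/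
def basicOpen (a : α) : Set (StoneSpace α) := {x | a ∈ x.carrier}

/-- The topology generated by the sets `basicOpen a` (which are closed under finite intersections,
hence a basis). -/
instance : TopologicalSpace (StoneSpace α) :=
  TopologicalSpace.generateFrom (Set.range basicOpen)

theorem isOpen_basicOpen (a : α) : IsOpen (basicOpen a) :=
  TopologicalSpace.isOpen_generateFrom_of_mem ⟨a, rfl⟩

theorem compl_mem_iff (x : StoneSpace α) (a : α) : aᶜ ∈ x.carrier ↔ a ∉ x.carrier := by
  constructor
  · intro h h'
    have := x.inf_mem h' h
    rw [inf_compl_eq_bot] at this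
    exact x.bot_notMem this
  · intro h
    exact (x.mem_or_compl_mem a).resolve_left h

instance : T2Space (StoneSpace α) := by
  have key : ∀ (x y : StoneSpace α) (a : α), a ∈ x.carrier → a ∉ y.carrier →
      ∃ u v : Set (StoneSpace α), IsOpen u ∧ IsOpen v ∧ x ∈ u ∧ y ∈ v ∧ Disjoint u v := by
    intro x y a hx hy
    refine ⟨basicOpen a, basicOpen aᶜ, isOpen_basicOpen _, isOpen_basicOpen _, hx,
      (compl_mem_iff y a).2 hy, ?_⟩
    rw [Set.disjoint_left]
    intro z hz hz'
    exact (compl_mem_iff z a).1 hz' hz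
  refine ⟨fun x y hxy => ?_⟩
  by_contra hcon
  apply hxy
  ext a
  by_cases hx : a ∈ x.carrier
  · by_cases hy : a ∈ y.carrier
    · simp [hx, hy]
    · exact absurd (key x y a hx hy) hcon
  · by_cases hy : a ∈ y.carrier
    · obtain ⟨s, t, hs, ht, hys, hxt, hd⟩ := key y x a hy hx
      exact absurd ⟨t, s, ht, hs, hxt, hys, hd.symm⟩ hcon
    · simp [hx, hy]

instance : CompactSpace (StoneSpace α) := by
  refine ⟨isCompact_iff_ultrafilter_le_nhds.2 fun 𝓕 _ => ?_⟩
  have hcompl : ∀ a : α, basicOpen aᶜ = (basicOpen a)ᶜ := fun a => by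
    ext x
    exact compl_mem_iff x a
  refine ⟨⟨{a | basicOpen a ∈ 𝓕}, ?_, ?_, ?_, ?_, ?_⟩, Set.mem_univ _, ?_⟩
  · exact Filter.mem_of_superset Filter.univ_mem fun x _ => x.top_mem
  · intro h
    obtain ⟨x, hx⟩ := 𝓕.neBot.nonempty_of_mem h
    exact x.bot_notMem hx
  · intro a b ha hb
    exact Filter.mem_of_superset (Filter.inter_mem ha hb) fun x hx => x.inf_mem hx.1 hx.2
  · intro a b ha hab
    exact Filter.mem_of_superset ha fun x hx => x.mem_of_le hx hab
  · intro a
    simp only [Set.mem_ofPred_eq, hcompl]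
    exact 𝓕.mem_or_compl_mem _
  · rw [TopologicalSpace.nhds_generateFrom]
    refine le_iInf₂ fun s hs => ?_
    obtain ⟨hxs, a, rfl⟩ := hs
    exact Filter.le_principal_iff.2 hxs

end StoneSpace

section StoneFlow

variable {G : Type u} [Group G] {B : BooleanSubalgebra (Set G)} [IsTranslationInvariant B]

theorem leftTranslate_one (A : B) : leftTranslate (1 : G) A = A :=
  Subtype.ext (one_smul G (A : Set G))

theorem leftTranslate_mul (g h : G) (A : B) : leftTranslate (g * h) A = leftTranslate g (leftTranslate h A) :=
  Subtype.ext (mul_smul g h (A : Set G))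

/-- The action of `G` on the Stone space by left translation: `g x = {g A : A ∈ x}`, i.e.
`A ∈ g x` if and only if `g⁻¹ A ∈ x`. -/
instance : SMul G (StoneSpace B) where
  smul g x :=
    { carrier := {A | leftTranslate g⁻¹ A ∈ x.carrier}
      top_mem := by
        have : leftTranslate g⁻¹ (⊤ : B) = ⊤ := Subtype.ext Set.smul_set_univ
        simpa [this] using x.top_mem
      bot_notMem := by
        have : leftTranslate g⁻¹ (⊥ : B) = ⊥ := Subtype.ext Set.smul_set_empty
        simpa [this] using x.bot_notMem
      inf_mem := by
        intro a b ha hb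
        have : leftTranslate g⁻¹ (a ⊓ b) = leftTranslate g⁻¹ a ⊓ leftTranslate g⁻¹ b :=
          Subtype.ext Set.smul_set_inter
        simpa [this] using x.inf_mem ha hb
      mem_of_le := by
        intro a b ha hab
        exact x.mem_of_le ha (Set.smul_set_mono hab)
      mem_or_compl_mem := by
        intro a
        have : leftTranslate g⁻¹ aᶜ = (leftTranslate g⁻¹ a)ᶜ := Subtype.ext Set.smul_set_compl
        simpa [this] using x.mem_or_compl_mem (leftTranslate g⁻¹ a) }

theorem StoneSpace.mem_smul_iff (g : G) (x : StoneSpace B) (A : B) :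
    A ∈ (g • x).carrier ↔ leftTranslate g⁻¹ A ∈ x.carrier := Iff.rfl

instance : MulAction G (StoneSpace B) where
  one_smul x := by
    ext A
    rw [StoneSpace.mem_smul_iff, inv_one, leftTranslate_one]
  mul_smul g h x := by
    ext A
    rw [StoneSpace.mem_smul_iff, StoneSpace.mem_smul_iff, StoneSpace.mem_smul_iff, mul_inv_rev,
      leftTranslate_mul]

instance : ContinuousConstSMul G (StoneSpace B) where
  continuous_const_smul g := by
    refine continuous_generateFrom_iff.2 ?_
    rintro _ ⟨A, rfl⟩
    exact StoneSpace.isOpen_basicOpen (leftTranslate g⁻¹ A)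

end StoneFlow

/-!
The statement is translated from measures to states, the positive unital functionals on `C(X, ℝ)`:
a flow `X` is minimal and strongly proximal if and only if for every state `φ`, every `h` and every
point `x` some translate satisfies `φ (h ∘ g) > h x - ε` (`IsBoundary`). The Riesz–Markov–Kakutani
theorem gives one direction, `IsMinimalStronglyProximal.isBoundary`; the other one,
`IsBoundary.isMinimalStronglyProximal`, is integration.

Let `B` be an invariant algebra all of whose non-empty elements are strongly completely syndetic.
On the finite algebra generated by finitely many translates of `A ∈ B`, a state on `C(X, ℝ)`, where
`X` is the Stone space of `B`, is approximated by averages over multisets in `G`, so some translate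
of it gives almost full mass to the clopen set defined by `A`. Hence `X` is a boundary
(`StoneSpace.isBoundary`). Conversely, the return times of a point of a boundary to a non-empty
open set are strongly completely syndetic (`IsBoundary.isStronglyCompletelySyndetic`), since
otherwise the averages over bad multisets accumulate at a state that contradicts the definition.

Now let `B` be maximal and let `Y` be a boundary. A minimal subset `Z` of `X × Y` is a boundary
(`IsBoundary.of_joining`), and its projection to `X` is injective (`injective_of_maximal`). For the
latter, choose an ultrafilter `P` on `Z` that contains all dense open sets and converges to a point
over the principal ultrafilter at `1`. The sets `{g | g⁻¹ S ∈ P}`, with `S` of nowhere dense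
boundary, form an invariant algebra of the same kind that contains `B`, and so is equal to `B`. This
means that an open subset of `Z` agrees with the preimage of a clopen subset of `X` up to a nowhere
dense set, so clopen subsets of `X` separate the points of `Z`. Therefore `Z` is isomorphic to `X`,
and `Y` is a factor of `X`.

Uniqueness follows because a boundary has no equivariant continuous self-map except the identity
(`IsBoundary.eq_id`).
-/

/-! ### States on `C(X, ℝ)` -/

/-- A state on `C(X, ℝ)`: a positive unital linear functional. On a compact Hausdorff space the
states are the integrals against regular Borel probability measures. -/
structure State (X : Type*) [TopologicalSpace X] where
  toLinearMap : C(X, ℝ) →ₗ[ℝ] ℝ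
  nonneg : ∀ f : C(X, ℝ), (∀ x, 0 ≤ f x) → 0 ≤ toLinearMap f
  map_one : toLinearMap 1 = 1

namespace State

variable {X : Type*} {Y : Type*} [TopologicalSpace X] [TopologicalSpace Y]

instance : CoeFun (State X) (fun _ => C(X, ℝ) → ℝ) := ⟨fun φ => φ.toLinearMap⟩

theorem mono (φ : State X) {f g : C(X, ℝ)} (h : ∀ x, f x ≤ g x) : φ f ≤ φ g := by
  have := φ.nonneg (g - f) fun x => sub_nonneg.2 (h x)
  rw [map_sub] at this
  linarith

theorem map_const (φ : State X) (c : ℝ) : φ (ContinuousMap.const X c) = c := by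
  have : ContinuousMap.const X c = c • (1 : C(X, ℝ)) := by
    ext; simp
  rw [this, map_smul, φ.map_one]
  simp

/-- The push-forward of a state along a continuous map. -/
def map (a : C(X, Y)) (φ : State X) : State Y where
  toLinearMap :=
    { toFun := fun f => φ (f.comp a)
      map_add' := fun f g => by rw [ContinuousMap.add_comp, map_add]
      map_smul' := fun c f => by rw [ContinuousMap.smul_comp, map_smul]; rfl }
  nonneg f hf := φ.nonneg _ fun x => hf (a x)
  map_one := φ.map_one

theorem map_apply (a : C(X, Y)) (φ : State X) (f : C(Y, ℝ)) : φ.map a f = φ (f.comp a) := rfl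

/-- Evaluation at a point. -/
def eval (x : X) : State X where
  toLinearMap :=
    { toFun := fun f => f x
      map_add' := fun _ _ => rfl
      map_smul' := fun _ _ => rfl }
  nonneg _ hf := hf x
  map_one := rfl

theorem eval_apply (x : X) (f : C(X, ℝ)) : eval x f = f x := rfl

/-- The average of a function over the values of `y` on a non-empty finite multiset. -/
noncomputable def average {ι : Type*} (y : ι → X) (K : Multiset ι) (hK : 0 < K.card) :
    State X where
  toLinearMap :=
    { toFun := fun f => (K.card : ℝ)⁻¹ * (K.map fun k => f (y k)).sum
      map_add' := fun f g => by
        simp only [ContinuousMap.add_apply, Multiset.sum_map_add, mul_add]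
      map_smul' := fun c f => by
        simp only [ContinuousMap.smul_apply, smul_eq_mul, Multiset.sum_map_mul_left,
          RingHom.id_apply]
        ring }
  nonneg f hf := by
    refine mul_nonneg (by positivity) (Multiset.sum_nonneg ?_)
    simp only [Multiset.mem_map]
    rintro _ ⟨k, -, rfl⟩
    exact hf (y k)
  map_one := by
    have : (K.card : ℝ) ≠ 0 := by positivity
    simp [this]

theorem average_apply {ι : Type*} (y : ι → X) (K : Multiset ι) (hK : 0 < K.card) (f : C(X, ℝ)) :
    average y K hK f = (K.card : ℝ)⁻¹ * (K.map fun k => f (y k)).sum := rfl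

/-- The state space is compact: a family of states converges pointwise along any ultrafilter. -/
theorem exists_tendsto [CompactSpace X] {ι : Type*} (U : Ultrafilter ι) (φ : ι → State X) :
    ∃ ψ : State X, ∀ f, Tendsto (fun i => φ i f) U (𝓝 (ψ f)) := by
  have h : ∀ f : C(X, ℝ), ∃ c : ℝ, Tendsto (fun i => φ i f) U (𝓝 c) := fun f => by
    obtain ⟨c, -, hc⟩ := (isCompact_Icc (a := -‖f‖) (b := ‖f‖)).ultrafilter_le_nhds
      (U.map fun i => φ i f) (le_principal_iff.2 <| mem_map.2 <| univ_mem' fun i => by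
        constructor
        · rw [← (φ i).map_const (-‖f‖)]
          exact (φ i).mono fun x => (abs_le.1 (f.norm_coe_le_norm x)).1
        · rw [← (φ i).map_const (‖f‖)]
          exact (φ i).mono fun x => (abs_le.1 (f.norm_coe_le_norm x)).2)
    exact ⟨c, hc⟩
  choose L hL using h
  refine ⟨⟨{ toFun := L, map_add' := fun f g => ?_, map_smul' := fun c f => ?_ },
    fun f hf => ?_, ?_⟩, hL⟩
  · exact tendsto_nhds_unique (hL (f + g)) (by simpa using (hL f).add (hL g))
  · exact tendsto_nhds_unique (hL (c • f)) (by simpa using (hL f).const_mul c)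
  · exact ge_of_tendsto' (hL f) fun i => (φ i).nonneg f hf
  · exact tendsto_nhds_unique (hL 1) (by simp [State.map_one])

/-- A common zero of all non-negative functions on which the state vanishes is a point of the
support of the state. A state supported at one point at most is the evaluation at this point. -/
theorem exists_eq_eval [CompactSpace X] (ψ : State X)
    (huniq : ∀ x y : X, (∀ k : C(X, ℝ), (∀ z, 0 ≤ k z) → ψ k = 0 → k x = 0) →
      (∀ k : C(X, ℝ), (∀ z, 0 ≤ k z) → ψ k = 0 → k y = 0) → x = y) :
    ∃ x, ∀ f, ψ f = f x := by
  -- By compactness, a closed set without support points is covered by one null function.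
  have key : ∀ D : Set X, IsClosed D →
      (∀ x ∈ D, ∃ k : C(X, ℝ), (∀ z, 0 ≤ k z) ∧ ψ k = 0 ∧ k x ≠ 0) →
      ∃ k : C(X, ℝ), (∀ z, 0 ≤ k z) ∧ ψ k = 0 ∧ ∀ x ∈ D, 1 ≤ k x := by
    intro D hD h
    refine hD.isCompact.induction_on (p := fun D => ∃ k : C(X, ℝ), (∀ z, 0 ≤ k z) ∧ ψ k = 0 ∧
      ∀ x ∈ D, 1 ≤ k x) ⟨0, fun _ => le_rfl, map_zero _, by simp⟩ ?_ ?_ ?_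
    · rintro s t hst ⟨k, h0, h1, h2⟩
      exact ⟨k, h0, h1, fun x hx => h2 x (hst hx)⟩
    · rintro s t ⟨k, h0, h1, h2⟩ ⟨k', h0', h1', h2'⟩
      refine ⟨k + k', fun z => add_nonneg (h0 z) (h0' z), by rw [map_add, h1, h1', add_zero], ?_⟩
      rintro x (hx | hx)
      · have := h2 x hx
        have h3 : 0 ≤ k' x := h0' x
        simp only [ContinuousMap.add_apply]
        linarith
      · have := h2' x hx
        have h3 : 0 ≤ k x := h0 x
        simp only [ContinuousMap.add_apply]
        linarith
    · intro x hx
      obtain ⟨k, h0, h1, h2⟩ := h x hx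
      have hpos : 0 < k x := lt_of_le_of_ne (h0 x) (Ne.symm h2)
      refine ⟨{y | k x / 2 < k y}, mem_nhdsWithin_of_mem_nhds
        ((isOpen_lt continuous_const k.continuous).mem_nhds (half_lt_self hpos)),
        (k x / 2)⁻¹ • k, fun y => ?_, by rw [map_smul, h1, smul_zero], fun y hy => ?_⟩
      · exact mul_nonneg (by positivity) (h0 y)
      · have hy' : k x / 2 < k y := hy
        simp only [ContinuousMap.smul_apply, smul_eq_mul]
        rw [inv_mul_eq_div, one_le_div (by positivity)]
        exact hy'.le
  obtain ⟨x, hx⟩ : ∃ x, ∀ k : C(X, ℝ), (∀ z, 0 ≤ k z) → ψ k = 0 → k x = 0 := by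
    by_contra! h
    obtain ⟨k, -, h1, h2⟩ := key Set.univ isClosed_univ fun x _ => h x
    have : ψ 1 ≤ ψ k := ψ.mono fun x => h2 x trivial
    rw [h1, ψ.map_one] at this
    linarith
  refine ⟨x, fun f => ?_⟩
  have hle : ∀ ε > 0, |ψ f - f x| ≤ ε := by
    intro ε hε
    obtain ⟨k, h0, h1, h2⟩ := key {y | ε ≤ |f y - f x|}
      (isClosed_le continuous_const (by fun_prop)) fun y hy => by
        by_contra! hcon
        have : y = x := huniq y x (fun k hk hk' => hcon k hk hk') hx
        subst this
        simp only [sub_self, abs_zero, Set.mem_ofPred_eq] at hy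
        linarith
    have hb : ∀ y, |f y - f x| ≤ ε + (2 * ‖f‖) * k y := by
      intro y
      have hk : 0 ≤ k y := h0 y
      by_cases hy : ε ≤ |f y - f x|
      · have h3 := h2 y hy
        have h4 : |f y| ≤ ‖f‖ := f.norm_coe_le_norm y
        have h5 : |f x| ≤ ‖f‖ := f.norm_coe_le_norm x
        have h6 := abs_sub (f y) (f x)
        have h7 : 2 * ‖f‖ * 1 ≤ 2 * ‖f‖ * k y :=
          mul_le_mul_of_nonneg_left h3 (by positivity)
        linarith
      · have : 0 ≤ 2 * ‖f‖ * k y := by positivity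
        linarith
    have hup : ψ f ≤ ψ (ContinuousMap.const X (f x + ε) + (2 * ‖f‖) • k) :=
      ψ.mono fun y => by
        have := (abs_le.1 (hb y)).2
        simp only [ContinuousMap.add_apply, ContinuousMap.const_apply, ContinuousMap.smul_apply,
          smul_eq_mul]
        linarith
    have hlow : ψ (ContinuousMap.const X (f x - ε) - (2 * ‖f‖) • k) ≤ ψ f :=
      ψ.mono fun y => by
        have := (abs_le.1 (hb y)).1
        simp only [ContinuousMap.sub_apply, ContinuousMap.const_apply, ContinuousMap.smul_apply,
          smul_eq_mul]
        linarith
    rw [map_add, map_smul, h1, ψ.map_const] at hup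
    rw [map_sub, map_smul, h1, ψ.map_const] at hlow
    simp only [smul_zero] at hup hlow
    rw [abs_le]
    constructor <;> linarith
  have : |ψ f - f x| ≤ 0 := le_of_forall_pos_le_add fun ε hε => by simpa using hle ε hε
  exact sub_eq_zero.1 (abs_nonpos_iff.1 this)

end State

/-! ### Boundaries in terms of states -/

/-- Translation by `g`, as a continuous map. -/
def actMap {G : Type*} {X : Type*} [Group G] [TopologicalSpace X] [MulAction G X]
    [ContinuousConstSMul G X] (g : G) : C(X, X) := ⟨fun x => g • x, continuous_const_smul g⟩

theorem actMap_apply {G : Type*} {X : Type*} [Group G] [TopologicalSpace X] [MulAction G X]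
    [ContinuousConstSMul G X] (g : G) (x : X) : actMap g x = g • x := rfl

theorem comp_actMap_comp {G : Type*} {X : Type*} [Group G] [TopologicalSpace X] [MulAction G X]
    [ContinuousConstSMul G X] (f : C(X, ℝ)) (g h : G) :
    (f.comp (actMap g)).comp (actMap h) = f.comp (actMap (g * h)) := by
  ext x
  simp [actMap_apply, mul_smul]

/-- The functional-analytic form of "minimal and strongly proximal": the translates of any state
push any continuous function arbitrarily close to any of its values from below. -/
structure IsBoundary (G : Type*) (X : Type*) [Group G] [TopologicalSpace X] [MulAction G X]
    [ContinuousConstSMul G X] : Prop where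
  nonempty : Nonempty X
  exists_lt : ∀ (φ : State X) (h : C(X, ℝ)) (x : X) (c : ℝ), c < h x →
    ∃ g : G, c < φ (h.comp (actMap g))

/-- Urysohn's lemma for a point of an open set. -/
theorem exists_bump {X : Type*} [TopologicalSpace X] [CompactSpace X] [T2Space X] {x : X}
    {U : Set X} (hU : IsOpen U) (hx : x ∈ U) :
    ∃ h : C(X, ℝ), h x = 1 ∧ (∀ y, 0 ≤ h y) ∧ (∀ y, h y ≤ 1) ∧ ∀ y, y ∉ U → h y = 0 := by
  obtain ⟨h, h0, h1, h2⟩ := exists_continuous_zero_one_of_isClosed (s := Uᶜ) (t := {x})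
    hU.isClosed_compl isClosed_singleton (by simpa using hx)
  exact ⟨h, h1 rfl, fun y => (h2 y).1, fun y => (h2 y).2, fun y hy => h0 hy⟩

namespace IsBoundary

variable {G : Type*} {X : Type*} [Group G] [TopologicalSpace X] [MulAction G X]
  [ContinuousConstSMul G X]

/-- The orbit closure of every state contains the evaluation at every point. -/
theorem exists_tendsto_eval (hX : IsBoundary G X) (φ : State X) (x : X) :
    ∃ l : Filter G, l.NeBot ∧
      ∀ f : C(X, ℝ), Tendsto (fun g => φ (f.comp (actMap g))) l (𝓝 (f x)) := by
  classical
  have key : ∀ p : Finset C(X, ℝ) × ℕ, ∃ g : G, ∀ f ∈ p.1,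
      |φ (f.comp (actMap g)) - f x| ≤ 1 / ((p.2 : ℝ) + 1) := by
    rintro ⟨S, n⟩
    -- A single function controls all the members of `S`.
    let d : C(X, ℝ) → C(X, ℝ) := fun f => ⟨fun y => |f y - f x|, by fun_prop⟩
    obtain ⟨g, hg⟩ := hX.exists_lt φ (-∑ f ∈ S, d f) x (-(1 / ((n : ℝ) + 1))) (by
      have : (0 : ℝ) < 1 / ((n : ℝ) + 1) := by positivity
      simpa [d] using this)
    refine ⟨g, fun f hf => ?_⟩
    have hg' : φ ((∑ f ∈ S, d f).comp (actMap g)) < 1 / ((n : ℝ) + 1) := by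
      have h1 : (-∑ f ∈ S, d f).comp (actMap g) = -((∑ f ∈ S, d f).comp (actMap g)) := by
        ext; simp
      rw [h1, map_neg] at hg
      linarith
    have hle : φ ((d f).comp (actMap g)) ≤ φ ((∑ f ∈ S, d f).comp (actMap g)) := by
      refine φ.mono fun y => ?_
      simp only [ContinuousMap.comp_apply, ContinuousMap.sum_apply]
      exact Finset.single_le_sum (f := fun f => d f (actMap g y)) (fun f _ => abs_nonneg _) hf
    have hup : φ (f.comp (actMap g)) ≤
        φ (ContinuousMap.const X (f x) + (d f).comp (actMap g)) := φ.mono fun y => by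
      have := le_abs_self (f (actMap g y) - f x)
      simp only [ContinuousMap.comp_apply, ContinuousMap.add_apply, ContinuousMap.const_apply, d,
        ContinuousMap.coe_mk]
      linarith
    have hlow : φ (ContinuousMap.const X (f x) - (d f).comp (actMap g)) ≤
        φ (f.comp (actMap g)) := φ.mono fun y => by
      have := neg_abs_le (f (actMap g y) - f x)
      simp only [ContinuousMap.comp_apply, ContinuousMap.sub_apply, ContinuousMap.const_apply, d,
        ContinuousMap.coe_mk]
      linarith
    rw [map_add, φ.map_const] at hup
    rw [map_sub, φ.map_const] at hlow
    rw [abs_le]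
    constructor <;> linarith
  choose γ hγ using key
  refine ⟨map γ atTop, inferInstance, fun f => ?_⟩
  rw [tendsto_map'_iff, tendsto_iff_dist_tendsto_zero]
  have hlim : Tendsto (fun p : Finset C(X, ℝ) × ℕ => 1 / ((p.2 : ℝ) + 1)) atTop (𝓝 0) := by
    rw [← prod_atTop_atTop_eq]
    exact tendsto_one_div_add_atTop_nhds_zero_nat.comp tendsto_snd
  refine squeeze_zero' (Eventually.of_forall fun _ => dist_nonneg) ?_ hlim
  filter_upwards [eventually_ge_atTop (({f}, 0) : Finset C(X, ℝ) × ℕ)] with p hp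
  exact hγ p f (hp.1 (Finset.mem_singleton_self f))

variable [CompactSpace X] [T2Space X]

theorem isMinimal (hX : IsBoundary G X) : MulAction.IsMinimal G X := by
  refine ⟨fun x => dense_iff_inter_open.2 fun U hU ⟨y, hy⟩ => ?_⟩
  obtain ⟨h, h1, -, -, h3⟩ := exists_bump hU hy
  obtain ⟨g, hg⟩ := hX.exists_lt (State.eval x) h y 0 (by rw [h1]; exact one_pos)
  refine ⟨g • x, ?_, g, rfl⟩
  by_contra hcon
  have : h (g • x) = 0 := h3 _ hcon
  rw [State.eval_apply, ContinuousMap.comp_apply, actMap_apply, this] at hg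
  exact lt_irrefl _ hg

/-- A continuous equivariant self-map of a boundary is the identity: points `x` and `α x` are
mapped close to each other by a common group element. -/
theorem eq_id (hX : IsBoundary G X) (α : X → X) (hα : Continuous α)
    (hequiv : ∀ (g : G) (x : X), α (g • x) = g • α x) (x : X) : α x = x := by
  by_contra hne
  obtain ⟨U, V, hU, hV, hxU, hxV, hd⟩ := t2_separation (Ne.symm hne)
  -- The bump function satisfies `h y + h (α y) ≤ 1` for all `y`, so the average of the evaluations
  -- at `x` and `α x` gives at most `1 / 2` to each of its translates.
  obtain ⟨h, h1, h2, h3, h4⟩ := exists_bump (hU.inter (hV.preimage hα)) ⟨hxU, hxV⟩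
  obtain ⟨g, hg⟩ := hX.exists_lt
    (State.average (fun i : Bool => cond i x (α x)) {true, false} (by simp)) h x (1 / 2)
    (by rw [h1]; norm_num)
  have hle : h (g • x) + h (g • α x) ≤ 1 := by
    by_cases hgx : g • x ∈ U ∩ α ⁻¹' V
    · have hVx : g • α x ∈ V := by rw [← hequiv]; exact hgx.2
      rw [h4 (g • α x) fun hU' => Set.disjoint_left.1 hd hU'.1 hVx]
      linarith [h3 (g • x)]
    · rw [h4 _ hgx]
      linarith [h3 (g • α x)]
  rw [State.average_apply] at hg
  simp [actMap_apply] at hg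
  linarith

end IsBoundary

/-! ### Regular Borel probability measures and states -/

section Measures

variable {G : Type u} {X : Type v} [Group G] [TopologicalSpace X]
  [MulAction G X] [ContinuousConstSMul G X]

theorem integral_translateMeasure [MeasurableSpace X] [BorelSpace X] (μ : ProbabilityMeasure X)
    (g : G) (f : C(X, ℝ)) :
    ∫ x, f x ∂(translateMeasure g μ : Measure X) =
      ∫ x, f.comp (actMap g) x ∂(μ : Measure X) := by
  have h := integral_map (μ := (μ : Measure X)) (φ := fun x : X => g • x) (f := f)
    (continuous_const_smul g).measurable.aemeasurable
    f.continuous.measurable.aestronglyMeasurable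
  exact h

variable [CompactSpace X]

/-- Convergence of translates to a point mass, tested on `C(X, ℝ)`. -/
theorem tendsto_translateMeasure_iff [MeasurableSpace X] [BorelSpace X] (μ : ProbabilityMeasure X)
    (x : X) (l : Filter G) :
    Tendsto (fun g => translateMeasure g μ) l (𝓝 (pointMass x)) ↔
      ∀ f : C(X, ℝ),
        Tendsto (fun g => ∫ y, f.comp (actMap g) y ∂(μ : Measure X)) l (𝓝 (f x)) := by
  rw [ProbabilityMeasure.tendsto_iff_forall_integral_tendsto]
  have hdirac : ∀ f : C(X, ℝ), ∫ y, f y ∂(pointMass x : Measure X) = f x := fun f =>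
    integral_dirac' _ _ f.continuous.measurable.stronglyMeasurable
  constructor
  · intro h f
    have := h (BoundedContinuousFunction.mkOfCompact f)
    simp only [BoundedContinuousFunction.mkOfCompact_apply, hdirac,
      integral_translateMeasure] at this
    exact this
  · intro h f
    have := h f.toContinuousMap
    simp only [← integral_translateMeasure, ← hdirac] at this
    exact this

variable [T2Space X]

/-- The Riesz–Markov–Kakutani theorem for states. -/
theorem State.exists_measure [MeasurableSpace X] [BorelSpace X] (φ : State X) :
    ∃ μ : ProbabilityMeasure X, (μ : Measure X).Regular ∧
      ∀ f : C(X, ℝ), ∫ x, f x ∂(μ : Measure X) = φ f := by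
  let Λ : CompactlySupportedContinuousMap X ℝ →ₚ[ℝ] ℝ :=
    { toFun := fun f => φ f.toContinuousMap
      map_add' := fun f g => map_add φ.toLinearMap f.toContinuousMap g.toContinuousMap
      map_smul' := fun c f => map_smul φ.toLinearMap c f.toContinuousMap
      monotone' := fun f g hfg => φ.mono hfg }
  have hint : ∀ f : C(X, ℝ), ∫ x, f x ∂(RealRMK.rieszMeasure Λ) = φ f := fun f =>
    RealRMK.integral_rieszMeasure Λ (CompactlySupportedContinuousMap.continuousMapEquiv f)
  have hprob : IsProbabilityMeasure (RealRMK.rieszMeasure Λ) := by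
    have h1 := hint 1
    rw [φ.map_one] at h1
    simp only [ContinuousMap.one_apply, integral_const, smul_eq_mul, mul_one] at h1
    exact ⟨by rwa [measureReal_def, ENNReal.toReal_eq_one_iff] at h1⟩
  exact ⟨⟨_, hprob⟩, RealRMK.regular_rieszMeasure Λ, hint⟩

theorem IsMinimalStronglyProximal.isBoundary (hX : IsMinimalStronglyProximal G X) :
    IsBoundary G X := by
  refine ⟨hX.nonempty, fun φ h x c hc => ?_⟩
  let _ : MeasurableSpace X := borel X
  have _ : BorelSpace X := ⟨rfl⟩
  have := hX.minimal
  obtain ⟨μ, hreg, hμ⟩ := φ.exists_measure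
  obtain ⟨y, l, hl, hlim⟩ := hX.stronglyProximal μ hreg
  rw [tendsto_translateMeasure_iff] at hlim
  obtain ⟨g₀, hg₀⟩ := (isOpen_lt continuous_const h.continuous).exists_smul_mem G y ⟨x, hc⟩
  obtain ⟨g, hg⟩ := ((hlim (h.comp (actMap g₀))).eventually (lt_mem_nhds hg₀)).exists
  exact ⟨g₀ * g, by rwa [comp_actMap_comp, hμ] at hg⟩

theorem IsBoundary.isMinimalStronglyProximal (hX : IsBoundary G X) :
    IsMinimalStronglyProximal G X := by
  refine ⟨hX.nonempty, hX.isMinimal, fun μ _ => ?_⟩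
  have hint : ∀ f : C(X, ℝ), Integrable f (μ : Measure X) := fun f =>
    (BoundedContinuousFunction.mkOfCompact f).integrable _
  let φ : State X :=
    { toLinearMap :=
        { toFun := fun f => ∫ x, f x ∂(μ : Measure X)
          map_add' := fun f g => integral_add (hint f) (hint g)
          map_smul' := fun c f => integral_smul c f }
      nonneg := fun f hf => integral_nonneg hf
      map_one := by simp }
  obtain ⟨x⟩ := hX.nonempty
  obtain ⟨l, hl, hlim⟩ := hX.exists_tendsto_eval φ x
  exact ⟨x, l, hl, (tendsto_translateMeasure_iff μ x l).2 hlim⟩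

end Measures

/-! ### Return times to open subsets of a boundary -/

open Classical in
theorem translateInterCard_eq_sum {G : Type u} [Group G] (f : G) (K : Multiset G) (A : Set G) :
    (translateInterCard f K A : ℝ) = (K.map fun k => if f * k ∈ A then (1 : ℝ) else 0).sum := by
  unfold translateInterCard
  induction K using Multiset.induction_on with
  | empty => simp
  | cons a K ih =>
    rw [Multiset.map_cons, Multiset.map_cons, Multiset.sum_cons, ← ih]
    by_cases h : f * a ∈ A
    · rw [Multiset.filter_cons_of_pos _ h, Multiset.card_cons, if_pos h]
      push_cast
      ring
    · rw [Multiset.filter_cons_of_neg _ h, if_neg h, zero_add]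

theorem IsStronglyCompletelySyndetic.mono {G : Type u} [Group G] {A A' : Set G}
    (hA : IsStronglyCompletelySyndetic A) (h : A ⊆ A') : IsStronglyCompletelySyndetic A' := by
  intro ε hε
  obtain ⟨F, hF⟩ := hA ε hε
  refine ⟨F, fun K => ?_⟩
  obtain ⟨f, hf, hK⟩ := hF K
  refine ⟨f, hf, hK.trans (Nat.cast_le.2 ?_)⟩
  classical
  exact Multiset.card_le_card (Multiset.monotone_filter_right _ fun k hk => h hk)

/-- The set of return times to a non-empty open subset of a boundary is strongly completely
syndetic: otherwise the averages over a family of bad multisets accumulate at a state that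
violates strong proximality. -/
theorem IsBoundary.isStronglyCompletelySyndetic {G : Type u} {X : Type*} [Group G]
    [TopologicalSpace X] [CompactSpace X] [T2Space X] [MulAction G X] [ContinuousConstSMul G X]
    (hX : IsBoundary G X) (z : X) {U : Set X} (hU : IsOpen U) (hne : U.Nonempty) :
    IsStronglyCompletelySyndetic {g : G | g • z ∈ U} := by
  classical
  intro ε hε
  by_contra! hcon
  have key : ∀ F : Finset G, ∃ K : Multiset G, 0 < K.card ∧
      ∀ f ∈ F, (translateInterCard f K {g : G | g • z ∈ U} : ℝ) < (1 - ε) * K.card := by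
    intro F
    -- Adding `1` keeps the finite set non-empty, which excludes the empty multiset.
    obtain ⟨K, hK⟩ := hcon (insert 1 F)
    refine ⟨K, ?_, fun f hf => hK f (Finset.mem_insert_of_mem hf)⟩
    by_contra! h0
    have := hK 1 (Finset.mem_insert_self 1 F)
    rw [Nat.le_zero.1 h0, Nat.cast_zero, mul_zero] at this
    exact (Nat.cast_nonneg _).not_gt this
  choose K hK hbad using key
  obtain ⟨ψ, hψ⟩ := State.exists_tendsto (Ultrafilter.of (atTop : Filter (Finset G)))
    fun F => State.average (fun k : G => k • z) (K F) (hK F)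
  obtain ⟨x, hx⟩ := hne
  obtain ⟨h, h1, h2, h3, h4⟩ := exists_bump hU hx
  obtain ⟨g, hg⟩ := hX.exists_lt ψ h x (1 - ε) (by rw [h1]; linarith)
  have hev : ∀ᶠ F in (Ultrafilter.of (atTop : Filter (Finset G)) : Filter (Finset G)), g ∈ F :=
    Ultrafilter.of_le _ (mem_of_superset (mem_atTop ({g} : Finset G))
      fun F hF => hF (Finset.mem_singleton_self g))
  obtain ⟨F, hF, hgF⟩ := (((hψ _).eventually (lt_mem_nhds hg)).and hev).exists
  refine lt_asymm hF ?_
  have hpos : (0 : ℝ) < (K F).card := Nat.cast_pos.2 (hK F)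
  rw [State.average_apply, inv_mul_lt_iff₀ hpos, mul_comm]
  refine lt_of_le_of_lt ?_ (hbad F g hgF)
  rw [translateInterCard_eq_sum]
  refine Multiset.sum_map_le_sum_map _ _ fun k _ => ?_
  rw [ContinuousMap.comp_apply, actMap_apply, smul_smul]
  by_cases hk : g * k ∈ {g : G | g • z ∈ U}
  · rw [if_pos hk]
    exact h3 _
  · rw [if_neg hk, h4 _ hk]

/-! ### Joinings of boundaries -/

/-- A minimal joining of two boundaries is a boundary. The orbit closure of a state contains a
state whose first marginal is a point mass; the orbit closure of the latter contains a state both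
of whose marginals are point masses, and such a state is an evaluation. -/
theorem IsBoundary.of_joining {G : Type*} {X Y Z : Type*} [Group G]
    [TopologicalSpace X] [CompactSpace X] [T2Space X] [MulAction G X] [ContinuousConstSMul G X]
    [TopologicalSpace Y] [CompactSpace Y] [T2Space Y] [MulAction G Y] [ContinuousConstSMul G Y]
    [TopologicalSpace Z] [CompactSpace Z] [MulAction G Z] [ContinuousConstSMul G Z]
    [MulAction.IsMinimal G Z] [Nonempty Z] (hX : IsBoundary G X) (hY : IsBoundary G Y)
    (a : C(Z, X)) (b : C(Z, Y)) (ha : ∀ (g : G) z, a (g • z) = g • a z)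
    (hb : ∀ (g : G) z, b (g • z) = g • b z)
    (hinj : ∀ z z', a z = a z' → b z = b z' → z = z') : IsBoundary G Z := by
  refine ⟨inferInstance, fun φ h z c hc => ?_⟩
  have hac : ∀ (f : C(X, ℝ)) (g : G), (f.comp a).comp (actMap g) = (f.comp (actMap g)).comp a :=
    fun f g => by ext z; simp [actMap_apply, ha]
  have hbc : ∀ (f : C(Y, ℝ)) (g : G), (f.comp b).comp (actMap g) = (f.comp (actMap g)).comp b :=
    fun f g => by ext z; simp [actMap_apply, hb]
  obtain ⟨x₀⟩ := hX.nonempty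
  obtain ⟨y₀⟩ := hY.nonempty
  obtain ⟨l₁, hl₁, hlim₁⟩ := hX.exists_tendsto_eval (φ.map a) x₀
  obtain ⟨φ₁, hφ₁⟩ := State.exists_tendsto (Ultrafilter.of l₁) fun g => φ.map (actMap g)
  have hφ₁a : ∀ f : C(X, ℝ), φ₁ (f.comp a) = f x₀ := fun f => by
    refine tendsto_nhds_unique (hφ₁ (f.comp a)) (((hlim₁ f).mono_left (Ultrafilter.of_le l₁)).congr
      fun g => ?_)
    rw [State.map_apply, State.map_apply, hac]
  obtain ⟨l₂, hl₂, hlim₂⟩ := hY.exists_tendsto_eval (φ₁.map b) y₀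
  obtain ⟨φ₂, hφ₂⟩ := State.exists_tendsto (Ultrafilter.of l₂) fun g => φ₁.map (actMap g)
  have hφ₂b : ∀ f : C(Y, ℝ), φ₂ (f.comp b) = f y₀ := fun f => by
    refine tendsto_nhds_unique (hφ₂ (f.comp b)) (((hlim₂ f).mono_left (Ultrafilter.of_le l₂)).congr
      fun g => ?_)
    rw [State.map_apply, State.map_apply, hbc]
  -- The first marginal remains a point mass, by compactness of `X`.
  obtain ⟨x₁, -, hx₁⟩ := isCompact_univ.ultrafilter_le_nhds
    ((Ultrafilter.of l₂).map fun g : G => g • x₀) (by simp)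
  have hφ₂a : ∀ f : C(X, ℝ), φ₂ (f.comp a) = f x₁ := fun f => by
    have hx₁' : Tendsto (fun g : G => g • x₀) (Ultrafilter.of l₂) (𝓝 x₁) := hx₁
    refine tendsto_nhds_unique (hφ₂ (f.comp a))
      (((f.continuous.tendsto x₁).comp hx₁').congr fun g => ?_)
    rw [State.map_apply, hac, hφ₁a]
    rfl
  have hsupp : ∀ z : Z, (∀ k : C(Z, ℝ), (∀ w, 0 ≤ k w) → φ₂ k = 0 → k z = 0) →
      a z = x₁ ∧ b z = y₀ := by
    intro z hz
    constructor
    · by_contra hne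
      obtain ⟨k, h1, h2, h3, h4⟩ := exists_bump (isOpen_compl_singleton (x := x₁)) hne
      have := hz (k.comp a) (fun w => h2 (a w)) (by rw [hφ₂a]; exact h4 _ (by simp))
      rw [ContinuousMap.comp_apply, h1] at this
      exact one_ne_zero this
    · by_contra hne
      obtain ⟨k, h1, h2, h3, h4⟩ := exists_bump (isOpen_compl_singleton (x := y₀)) hne
      have := hz (k.comp b) (fun w => h2 (b w)) (by rw [hφ₂b]; exact h4 _ (by simp))
      rw [ContinuousMap.comp_apply, h1] at this
      exact one_ne_zero this
  obtain ⟨z₂, hz₂⟩ := φ₂.exists_eq_eval fun z z' hz hz' =>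
    hinj z z' ((hsupp z hz).1.trans (hsupp z' hz').1.symm)
      ((hsupp z hz).2.trans (hsupp z' hz').2.symm)
  -- Minimality of `Z` moves the limit point `z₂` into the set where `h` exceeds `c`.
  obtain ⟨g₃, hg₃⟩ := (isOpen_lt continuous_const h.continuous).exists_smul_mem G z₂ ⟨z, hc⟩
  have h₂ : c < φ₂ (h.comp (actMap g₃)) := by rw [hz₂]; exact hg₃
  obtain ⟨g₂, hg₂⟩ := ((hφ₂ _).eventually (lt_mem_nhds h₂)).exists
  rw [State.map_apply] at hg₂
  obtain ⟨g₁, hg₁⟩ := ((hφ₁ _).eventually (lt_mem_nhds hg₂)).exists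
  rw [State.map_apply, comp_actMap_comp, comp_actMap_comp] at hg₁
  exact ⟨_, hg₁⟩

/-! ### Strong proximality of Stone spaces -/

namespace StoneSpace

theorem isTopologicalBasis_range_basicOpen {α : Type u} [BooleanAlgebra α] :
    TopologicalSpace.IsTopologicalBasis
      (Set.range (basicOpen : α → Set (StoneSpace α))) where
  exists_subset_inter := by
    rintro _ ⟨a, rfl⟩ _ ⟨b, rfl⟩ x ⟨ha, hb⟩
    exact ⟨_, ⟨a ⊓ b, rfl⟩, x.inf_mem ha hb, fun y hy =>
      ⟨y.mem_of_le hy inf_le_left, y.mem_of_le hy inf_le_right⟩⟩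
  sUnion_eq := Set.eq_univ_of_forall fun x => ⟨_, ⟨⊤, rfl⟩, x.top_mem⟩
  eq_generateFrom := rfl

theorem isClopen_basicOpen {α : Type u} [BooleanAlgebra α] (a : α) :
    IsClopen (basicOpen a) := by
  refine ⟨⟨?_⟩, isOpen_basicOpen a⟩
  convert isOpen_basicOpen aᶜ using 1
  ext x
  exact (compl_mem_iff x a).symm

/-- The principal ultrafilter at `g`. -/
def principal {G : Type u} (B : BooleanSubalgebra (Set G)) (g : G) : StoneSpace B where
  carrier := {A | g ∈ (A : Set G)}
  top_mem := trivial
  bot_notMem := fun h => h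
  inf_mem := fun ha hb => ⟨ha, hb⟩
  mem_of_le := fun ha hab => hab ha
  mem_or_compl_mem := fun a => em (g ∈ (a : Set G))

theorem denseRange_principal {G : Type u} (B : BooleanSubalgebra (Set G)) :
    DenseRange (principal B) := by
  refine isTopologicalBasis_range_basicOpen.dense_iff.2 ?_
  rintro _ ⟨A, rfl⟩ ⟨x, hx⟩
  have hne : (A : Set G).Nonempty := by
    by_contra h
    have : A = ⊥ := Subtype.ext (Set.not_nonempty_iff_eq_empty.1 h)
    subst this
    exact x.bot_notMem hx
  obtain ⟨g, hg⟩ := hne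
  exact ⟨principal B g, hg, g, rfl⟩

theorem smul_principal {G : Type u} [Group G] (B : BooleanSubalgebra (Set G))
    [IsTranslationInvariant B] (f k : G) : f • principal B k = principal B (f * k) := by
  ext A
  rw [mem_smul_iff]
  change k ∈ f⁻¹ • (A : Set G) ↔ f * k ∈ (A : Set G)
  rw [Set.mem_inv_smul_set_iff, smul_eq_mul]

end StoneSpace

/-- A state on a finite discrete space is, up to rounding, the average over a multiset. -/
theorem State.exists_multiset {T : Type*} [Finite T] [TopologicalSpace T] [DiscreteTopology T]
    (φ : State T) {δ : ℝ} (hδ : 0 < δ) (hδ1 : δ < 1) :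
    ∃ K : Multiset T, 0 < K.card ∧ (∀ t ∈ K, ∃ u : C(T, ℝ), φ u ≠ 0 ∧ ∀ s, s ≠ t → u s = 0) ∧
      ∀ u : C(T, ℝ), (∀ t, 0 ≤ u t) → (1 - δ) * (K.map u).sum ≤ K.card * φ u := by
  classical
  have := Fintype.ofFinite T
  let e : T → C(T, ℝ) := fun t => ⟨fun s => if s = t then 1 else 0, continuous_of_discreteTopology⟩
  have hφ : ∀ u : C(T, ℝ), φ u = ∑ t, φ (e t) * u t := fun u => by
    have : u = ∑ t, u t • e t := by
      ext s
      simp [e]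
    conv_lhs => rw [this, map_sum]
    refine Finset.sum_congr rfl fun t _ => ?_
    rw [map_smul, smul_eq_mul, mul_comm]
  have he : ∀ t, 0 ≤ φ (e t) := fun t => φ.nonneg _ fun s => by
    change (0 : ℝ) ≤ if s = t then 1 else 0
    split_ifs <;> norm_num
  obtain ⟨N, hN⟩ := exists_nat_gt ((Fintype.card T : ℝ) / δ)
  have hNpos : (0 : ℝ) < N := lt_of_le_of_lt (by positivity) hN
  rw [div_lt_iff₀ hδ] at hN
  let n : T → ℕ := fun t => ⌊N * φ (e t)⌋₊
  have hn : ∀ t, (n t : ℝ) ≤ N * φ (e t) := fun t => Nat.floor_le (mul_nonneg hNpos.le (he t))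
  let K : Multiset T := ∑ t, n t • {t}
  have hsum : ∀ u : T → ℝ, (K.map u).sum = ∑ t, n t * u t := fun u => by
    refine (map_sum (Multiset.sumAddMonoidHom.comp (Multiset.mapAddMonoidHom u))
      (fun t => n t • ({t} : Multiset T)) Finset.univ).trans ?_
    refine Finset.sum_congr rfl fun t _ => ?_
    rw [map_nsmul, nsmul_eq_mul]
    simp
  have hone : ∑ t, φ (e t) = 1 := by
    rw [← φ.map_one, hφ 1]
    simp
  have hcard : (K.card : ℝ) = ∑ t, (n t : ℝ) := by
    simpa using hsum fun _ => 1
  have hlow : (1 - δ) * N ≤ K.card := by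
    have : ∑ t, (N * φ (e t) - 1) ≤ ∑ t, (n t : ℝ) :=
      Finset.sum_le_sum fun t _ => (Nat.sub_one_lt_floor _).le
    rw [Finset.sum_sub_distrib, ← Finset.mul_sum, hone] at this
    simp only [mul_one, Finset.sum_const, Finset.card_univ, nsmul_eq_mul] at this
    rw [hcard]
    linarith
  refine ⟨K, ?_, fun t ht => ⟨e t, fun h0 => ?_, fun s hs => if_neg hs⟩, fun u hu => ?_⟩
  · have : (0 : ℝ) < K.card := lt_of_lt_of_le (mul_pos (by linarith) hNpos) hlow
    exact_mod_cast this
  · obtain ⟨s, -, hs⟩ := Multiset.mem_sum.1 ht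
    have hst := Multiset.mem_of_mem_nsmul hs
    rw [Multiset.mem_singleton] at hst
    subst hst
    simp [n, h0] at hs
  · have h1 : (K.map u).sum ≤ N * φ u := by
      rw [hsum, hφ u, Finset.mul_sum]
      refine Finset.sum_le_sum fun t _ => ?_
      rw [← mul_assoc]
      exact mul_le_mul_of_nonneg_right (hn t) (hu t)
    calc (1 - δ) * (K.map u).sum ≤ (1 - δ) * (N * φ u) :=
          mul_le_mul_of_nonneg_left h1 (by linarith)
      _ = (1 - δ) * N * φ u := by ring
      _ ≤ K.card * φ u := mul_le_mul_of_nonneg_right hlow (φ.nonneg u hu)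

namespace StoneSpace

variable {G : Type u} {B : BooleanSubalgebra (Set G)}

/-- The indicator function of a basic clopen set. -/
noncomputable def indicator (A : B) : C(StoneSpace B, ℝ) :=
  (⟨fun b : Bool => cond b 1 0, continuous_of_discreteTopology⟩ : C(Bool, ℝ)).comp
    ⟨(basicOpen A).boolIndicator,
      (continuous_boolIndicator_iff_isClopen _).2 (isClopen_basicOpen A)⟩

theorem indicator_of_mem {A : B} {x : StoneSpace B} (h : x ∈ basicOpen A) :
    indicator A x = 1 := by
  have := (Set.mem_iff_boolIndicator _ _).1 h
  simp [indicator, this]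

theorem indicator_of_notMem {A : B} {x : StoneSpace B} (h : x ∉ basicOpen A) :
    indicator A x = 0 := by
  have := (Set.notMem_iff_boolIndicator _ _).1 h
  simp [indicator, this]

variable [Group G] [IsTranslationInvariant B]

/-- Strong complete syndeticity of `A` lets some translate of any state give almost full mass to
the clopen set defined by `A`: the state is approximated, on the finite algebra generated by the
relevant translates of `A`, by averages over multisets of principal ultrafilters. -/
theorem exists_translate_le_indicator (A : B) (hA : IsStronglyCompletelySyndetic (A : Set G))
    (φ : State (StoneSpace B)) {η : ℝ} (hη : 0 < η) :
    ∃ g : G, 1 - η ≤ φ ((indicator A).comp (actMap g)) := by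
  classical
  obtain ⟨δ, hδ, hδ1, hδη⟩ : ∃ δ : ℝ, 0 < δ ∧ δ < 1 ∧ 2 * δ ≤ η :=
    ⟨min (η / 2) (1 / 2), by positivity, (min_le_right _ _).trans_lt (by norm_num), by
      linarith [min_le_left (η / 2) (1 / 2)]⟩
  obtain ⟨F, hF⟩ := hA δ hδ
  -- The atoms of the finite algebra are the fibres of the itinerary map `c`.
  let c : C(StoneSpace B, F → Bool) :=
    ⟨fun x f => (basicOpen A).boolIndicator ((f : G) • x), continuous_pi fun f =>
      ((continuous_boolIndicator_iff_isClopen _).2 (isClopen_basicOpen A)).comp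
        (continuous_const_smul (f : G))⟩
  obtain ⟨K, hK, hsupp, hle⟩ := (φ.map c).exists_multiset hδ hδ1
  have hreal : ∀ t : F → Bool, ∃ k : G, t ∈ K → c (principal B k) = t := by
    intro t
    by_cases ht : t ∈ K
    · obtain ⟨u, hu, hu'⟩ := hsupp t ht
      obtain ⟨x, hx⟩ : ∃ x, c x = t := by
        by_contra! hcon
        apply hu
        have : u.comp c = 0 := by
          ext x
          exact hu' _ (hcon x)
        rw [State.map_apply, this, map_zero]
      obtain ⟨k, hk⟩ := (denseRange_principal B).exists_mem_open
        ((isOpen_discrete {t}).preimage c.continuous) ⟨x, hx⟩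
      exact ⟨k, fun _ => hk⟩
    · exact ⟨1, fun h => absurd h ht⟩
  choose k hk using hreal
  obtain ⟨f, hf, hfK⟩ := hF (K.map k)
  refine ⟨f, ?_⟩
  let u : C(F → Bool, ℝ) := ⟨fun t => cond (t ⟨f, hf⟩) 1 0, continuous_of_discreteTopology⟩
  have huc : u.comp c = (indicator A).comp (actMap f) := rfl
  have hsum : (translateInterCard f (K.map k) (A : Set G) : ℝ) = (K.map u).sum := by
    rw [translateInterCard_eq_sum, Multiset.map_map]
    refine congrArg _ (Multiset.map_congr rfl fun t ht => ?_)
    have h1 : u t = indicator A (f • principal B (k t)) := by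
      conv_lhs => rw [← hk t ht]
      rfl
    rw [h1, smul_principal, Function.comp_apply]
    by_cases hmem : f * k t ∈ (A : Set G)
    · rw [if_pos hmem, indicator_of_mem hmem]
    · rw [if_neg hmem, indicator_of_notMem hmem]
  have h2 := hle u fun t => by
    change (0 : ℝ) ≤ cond (t ⟨f, hf⟩) 1 0
    cases t ⟨f, hf⟩ <;> simp
  rw [State.map_apply, huc, ← hsum] at h2
  rw [Multiset.card_map] at hfK
  have hpos : (0 : ℝ) < K.card := Nat.cast_pos.2 hK
  have h3 : (K.card : ℝ) * ((1 - δ) * (1 - δ)) ≤ K.card * φ ((indicator A).comp (actMap f)) := by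
    refine le_trans (le_of_eq ?_) ((mul_le_mul_of_nonneg_left hfK (by linarith)).trans h2)
    ring
  have h4 := le_of_mul_le_mul_left h3 hpos
  nlinarith [sq_nonneg δ]

theorem isBoundary (hB : ∀ A ∈ B, A.Nonempty → IsStronglyCompletelySyndetic A) :
    IsBoundary G (StoneSpace B) := by
  refine ⟨⟨principal B 1⟩, fun φ h x c hc => ?_⟩
  obtain ⟨c', hcc', hc'⟩ := exists_between hc
  obtain ⟨_, ⟨A, rfl⟩, hxA, hA⟩ := isTopologicalBasis_range_basicOpen.exists_subset_of_mem_open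
    (show x ∈ {y | c' < h y} from hc') (isOpen_lt continuous_const h.continuous)
  have hne : (A : Set G).Nonempty := by
    obtain ⟨_, hy, g, rfl⟩ := (denseRange_principal B).inter_open_nonempty _
      (isOpen_basicOpen A) ⟨x, hxA⟩
    exact ⟨g, hy⟩
  have hM : 0 ≤ c' + (‖h‖ + |c'|) := by
    have := neg_abs_le c'
    have := norm_nonneg h
    linarith
  obtain ⟨g, hg⟩ := exists_translate_le_indicator A (hB A A.2 hne) φ
    (η := (c' - c) / (c' + (‖h‖ + |c'|) + 1)) (div_pos (by linarith) (by linarith))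
  refine ⟨g, ?_⟩
  have hlow : φ ((c' + (‖h‖ + |c'|)) • (indicator A).comp (actMap g) -
      ContinuousMap.const _ (‖h‖ + |c'|)) ≤ φ (h.comp (actMap g)) := φ.mono fun y => by
    simp only [ContinuousMap.sub_apply, ContinuousMap.smul_apply, ContinuousMap.comp_apply,
      ContinuousMap.const_apply, smul_eq_mul]
    by_cases hy : actMap g y ∈ basicOpen A
    · have : c' < h (actMap g y) := hA hy
      rw [indicator_of_mem hy]
      linarith
    · have h1 := (abs_le.1 (h.norm_coe_le_norm (actMap g y))).1
      have h2 := abs_nonneg c'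
      rw [indicator_of_notMem hy]
      linarith
  rw [map_sub, map_smul, φ.map_const, smul_eq_mul] at hlow
  have h1 := mul_le_mul_of_nonneg_left hg hM
  have h2 : (c' + (‖h‖ + |c'|)) * ((c' - c) / (c' + (‖h‖ + |c'|) + 1)) < c' - c := by
    rw [mul_div_assoc', div_lt_iff₀ (by linarith)]
    nlinarith
  linarith

end StoneSpace

/-! ### Minimal subflows -/

theorem exists_minimal_subflow (G : Type*) (W : Type*) [Group G] [TopologicalSpace W]
    [CompactSpace W] [Nonempty W] [MulAction G W] [ContinuousConstSMul G W] :
    ∃ M : SubMulAction G W, IsClosed (M : Set W) ∧ (M : Set W).Nonempty ∧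
      MulAction.IsMinimal G M := by
  let S : Set (Set W) := {s | IsClosed s ∧ s.Nonempty ∧ ∀ (g : G), ∀ x ∈ s, g • x ∈ s}
  obtain ⟨m, -, hm⟩ := zorn_superset_nonempty S (by
    intro c hcS hc hne
    refine ⟨⋂₀ c, ⟨isClosed_sInter fun s hs => (hcS hs).1, ?_, fun g x hx s hs =>
      (hcS hs).2.2 g x (hx s hs)⟩, fun s hs => Set.sInter_subset_of_mem hs⟩
    exact IsCompact.nonempty_sInter_of_directed_nonempty_isCompact_isClosed (hS := hne.to_subtype)
      (fun s hs t ht => (hc.total hs ht).elim (fun h => ⟨s, hs, subset_rfl, h⟩)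
        fun h => ⟨t, ht, h, subset_rfl⟩) (fun s hs => (hcS hs).2.1) (fun s hs => (hcS hs).1.isCompact)
      (fun s hs => (hcS hs).1))
    Set.univ ⟨isClosed_univ, Set.univ_nonempty, fun _ _ _ => trivial⟩
  obtain ⟨hclosed, hne, hinv⟩ := hm.prop
  refine ⟨⟨m, fun g {x} hx => hinv g x hx⟩, hclosed, hne, ⟨fun x => ?_⟩⟩
  -- The orbit closure of a point of `m` is a closed invariant subset of `m`, hence all of `m`.
  have hsub : m ⊆ closure (MulAction.orbit G (x : W)) := by
    refine hm.le_of_le ⟨isClosed_closure, (MulAction.nonempty_orbit _).closure, ?_⟩ ?_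
    · intro g y hy
      exact map_mem_closure (continuous_const_smul g) hy fun z hz =>
        MulAction.mem_orbit_of_mem_orbit g hz
    · refine closure_minimal ?_ hclosed
      rintro _ ⟨g, rfl⟩
      exact hinv g _ x.2
  intro y
  rw [closure_subtype]
  convert hsub y.2 using 2
  ext z
  constructor
  · rintro ⟨_, ⟨g, rfl⟩, rfl⟩
    exact ⟨g, rfl⟩
  · rintro ⟨g, rfl⟩
    exact ⟨g • x, ⟨g, rfl⟩, rfl⟩

/-- An equivariant continuous map into a minimal flow is surjective. -/
theorem surjective_of_isMinimal (G : Type*) {X Y : Type*} [Group G] [TopologicalSpace X]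
    [CompactSpace X] [Nonempty X] [MulAction G X] [TopologicalSpace Y] [T2Space Y] [MulAction G Y]
    [MulAction.IsMinimal G Y] {α : X → Y} (hα : Continuous α)
    (hequiv : ∀ (g : G) x, α (g • x) = g • α x) : Function.Surjective α := by
  obtain ⟨x⟩ := ‹Nonempty X›
  rw [← Set.range_eq_univ]
  refine Set.eq_univ_of_univ_subset ?_
  rw [← (MulAction.dense_orbit G (α x)).closure_eq]
  refine closure_minimal ?_ (isCompact_range hα).isClosed
  rintro _ ⟨g, rfl⟩
  exact ⟨g • x, hequiv g x⟩

/-! ### Maximal algebras -/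

/-- The filter generated by the dense open sets. -/
def denseOpenFilter (Z : Type*) [TopologicalSpace Z] : Filter Z where
  sets := {S | Dense (interior S)}
  univ_sets := by simp
  sets_of_superset := fun h hst => h.mono (interior_mono hst)
  inter_sets := fun {s t} hs ht => by
    rw [Set.mem_ofPred_eq, interior_inter]
    exact hs.inter_of_isOpen_left ht isOpen_interior

section ReturnAlgebra

variable {Z : Type*} [TopologicalSpace Z]

instance neBot_nhds_inf_denseOpenFilter (z : Z) : (𝓝 z ⊓ denseOpenFilter Z).NeBot := by
  rw [inf_neBot_iff]
  intro s hs t ht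
  obtain ⟨y, hys, hyt⟩ := Dense.inter_open_nonempty ht _ isOpen_interior
    ⟨z, mem_interior_iff_mem_nhds.2 hs⟩
  exact ⟨y, interior_subset hys, interior_subset hyt⟩

variable {G : Type u} [Group G] [MulAction G Z]

/-- The times at which the ultrafilter `P` returns to the set `S`. -/
def returnSet (G : Type u) [Group G] [MulAction G Z] (P : Ultrafilter Z) (S : Set Z) : Set G :=
  {g | (fun z => g • z) ⁻¹' S ∈ P}

/-- The algebra of the sets of return times of the ultrafilter `P` to the subsets of `Z` with
nowhere dense boundary. -/
def returnAlgebra (G : Type u) [Group G] [MulAction G Z] (P : Ultrafilter Z) :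
    BooleanSubalgebra (Set G) where
  carrier := {A | ∃ S : Set Z, Dense (interior S ∪ interior Sᶜ) ∧ A = returnSet G P S}
  supClosed' := by
    rintro _ ⟨S, hS, rfl⟩ _ ⟨T, hT, rfl⟩
    refine ⟨S ∪ T, (hS.inter_of_isOpen_left hT
      (isOpen_interior.union isOpen_interior)).mono ?_, ?_⟩
    · rw [Set.compl_union, interior_inter]
      rintro z ⟨hz | hz, hz' | hz'⟩
      · exact Or.inl (interior_mono Set.subset_union_left hz)
      · exact Or.inl (interior_mono Set.subset_union_left hz)
      · exact Or.inl (interior_mono Set.subset_union_right hz')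
      · exact Or.inr ⟨hz, hz'⟩
    · ext g
      exact (Ultrafilter.union_mem_iff (f := P)).symm
  infClosed' := by
    rintro _ ⟨S, hS, rfl⟩ _ ⟨T, hT, rfl⟩
    refine ⟨S ∩ T, (hS.inter_of_isOpen_left hT
      (isOpen_interior.union isOpen_interior)).mono ?_, ?_⟩
    · rw [Set.compl_inter, interior_inter]
      rintro z ⟨hz | hz, hz' | hz'⟩
      · exact Or.inl ⟨hz, hz'⟩
      · exact Or.inr (interior_mono Set.subset_union_right hz')
      · exact Or.inr (interior_mono Set.subset_union_left hz)
      · exact Or.inr (interior_mono Set.subset_union_left hz)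
    · ext g
      exact (Filter.inter_mem_iff (f := (P : Filter Z))).symm
  compl_mem' := by
    rintro _ ⟨S, hS, rfl⟩
    refine ⟨Sᶜ, by rwa [compl_compl, Set.union_comm], ?_⟩
    ext g
    exact (Ultrafilter.compl_mem_iff_notMem (f := P)).symm
  bot_mem' := by
    refine ⟨∅, by simp, ?_⟩
    ext g
    simp [returnSet]

variable [ContinuousConstSMul G Z]

theorem preimage_smul_interior (g : G) (S : Set Z) :
    (fun z => g • z) ⁻¹' interior S = interior ((fun z => g • z) ⁻¹' S) :=
  (Homeomorph.smul g).preimage_interior S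

instance isTranslationInvariant_returnAlgebra (P : Ultrafilter Z) :
    IsTranslationInvariant (returnAlgebra G P) where
  smul_mem := by
    rintro h _ ⟨S, hS, rfl⟩
    refine ⟨(fun z => h⁻¹ • z) ⁻¹' S, ?_, ?_⟩
    · rw [← Set.preimage_compl, ← preimage_smul_interior, ← preimage_smul_interior,
        ← Set.preimage_union]
      exact hS.preimage (isOpenMap_smul h⁻¹)
    · ext g
      rw [Set.mem_smul_set_iff_inv_smul_mem]
      simp only [returnSet, Set.mem_ofPred_eq, smul_eq_mul, mul_smul]
      rfl

/-- Let the ultrafilter `P` converge to `z` and contain all dense open sets. A non-empty member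
of its return algebra contains the return times of `z` to a non-empty open set. -/
theorem isStronglyCompletelySyndetic_of_mem_returnAlgebra [CompactSpace Z] [T2Space Z]
    (hZ : IsBoundary G Z) {P : Ultrafilter Z} {z : Z}
    (hP : (P : Filter Z) ≤ 𝓝 z ⊓ denseOpenFilter Z) {A : Set G} (hA : A ∈ returnAlgebra G P)
    (hne : A.Nonempty) : IsStronglyCompletelySyndetic A := by
  obtain ⟨S, hS, rfl⟩ := hA
  have hSne : (interior S).Nonempty := by
    by_contra hemp
    rw [Set.not_nonempty_iff_eq_empty] at hemp
    rw [hemp, Set.empty_union] at hS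
    obtain ⟨g, hg⟩ := hne
    have hd : (fun z => g • z) ⁻¹' Sᶜ ∈ P := by
      refine (hP.trans inf_le_right) ?_
      change Dense (interior _)
      rw [← preimage_smul_interior]
      exact hS.preimage (isOpenMap_smul g)
    exact (Ultrafilter.compl_mem_iff_notMem (f := P)).1 hd hg
  refine (hZ.isStronglyCompletelySyndetic z isOpen_interior hSne).mono fun g hg => ?_
  refine (hP.trans inf_le_left) (mem_of_superset ?_ (Set.preimage_mono interior_subset))
  exact (isOpen_interior.preimage (continuous_const_smul g)).mem_nhds hg

/-- A boundary that maps onto the Stone space of a maximal algebra does so injectively: the return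
algebra of an ultrafilter that converges to a point over the principal ultrafilter at `1` contains,
hence equals, the maximal algebra; so every open set differs from the preimage of a clopen set by
a set with empty interior, which separates the points of the boundary. -/
theorem injective_of_maximal {B : BooleanSubalgebra (Set G)} [IsTranslationInvariant B]
    (hB : Maximal (fun C : BooleanSubalgebra (Set G) =>
      IsTranslationInvariant C ∧
        ∀ A : Set G, A ∈ C → A.Nonempty → IsStronglyCompletelySyndetic A) B)
    [CompactSpace Z] [T2Space Z] (hZ : IsBoundary G Z) (a : C(Z, StoneSpace B))
    (ha : ∀ (g : G) z, a (g • z) = g • a z) : Function.Injective a := by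
  have := (StoneSpace.isBoundary hB.prop.2).isMinimal
  have := hZ.isMinimal
  have := hZ.nonempty
  obtain ⟨z₀, hz₀⟩ := surjective_of_isMinimal G a.continuous ha (StoneSpace.principal B 1)
  let P : Ultrafilter Z := Ultrafilter.of (𝓝 z₀ ⊓ denseOpenFilter Z)
  have hP : (P : Filter Z) ≤ 𝓝 z₀ ⊓ denseOpenFilter Z := Ultrafilter.of_le _
  have hret : ∀ (A : B) (g : G),
      g • z₀ ∈ a ⁻¹' StoneSpace.basicOpen A ↔ g ∈ (A : Set G) := fun A g => by
    rw [Set.mem_preimage, ha, hz₀, StoneSpace.smul_principal, mul_one]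
    rfl
  have hopen : ∀ (U : Set Z) (g : G), IsOpen U → g • z₀ ∈ U → g ∈ returnSet G P U :=
    fun U g hU hg => (hP.trans inf_le_left)
      ((hU.preimage (continuous_const_smul g)).mem_nhds hg)
  have hdisj : ∀ (U V : Set Z) (g : G), Disjoint U V → g ∈ returnSet G P U →
      g ∉ returnSet G P V := fun U V g hd hU hV => by
    obtain ⟨z, hzU, hzV⟩ := P.neBot.nonempty_of_mem (inter_mem hU hV)
    exact Set.disjoint_left.1 hd hzU hzV
  have hle : B ≤ returnAlgebra G P := by
    intro A hA
    have hcl : IsClopen (a ⁻¹' StoneSpace.basicOpen (⟨A, hA⟩ : B)) :=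
      (StoneSpace.isClopen_basicOpen _).preimage a.continuous
    refine ⟨a ⁻¹' StoneSpace.basicOpen (⟨A, hA⟩ : B), ?_, ?_⟩
    · rw [hcl.isOpen.interior_eq, hcl.compl.isOpen.interior_eq, Set.union_compl_self]
      exact dense_univ
    · ext g
      rw [← hret ⟨A, hA⟩ g]
      constructor
      · exact hopen _ g hcl.isOpen
      · intro hg
        by_contra hcon
        exact hdisj _ _ g disjoint_compl_right hg (hopen _ g hcl.compl.isOpen hcon)
  have hge : returnAlgebra G P ≤ B := hB.le_of_ge ⟨inferInstance, fun A hA hne =>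
    isStronglyCompletelySyndetic_of_mem_returnAlgebra hZ hP hA hne⟩ hle
  intro z₁ z₂ h12
  by_contra hne
  obtain ⟨U, V, hU, hV, hzU, hzV, hd⟩ := t2_separation hne
  have hmem : returnSet G P U ∈ B := by
    refine hge ⟨U, ?_, rfl⟩
    rw [hU.interior_eq, interior_compl, dense_iff_closure_eq, closure_union]
    exact Set.eq_univ_of_forall fun z => (em (z ∈ closure U)).imp id fun h => subset_closure h
  -- `W` is the clopen set that corresponds to `U`; it contains `U` and misses `V`.
  let W : Set Z := a ⁻¹' StoneSpace.basicOpen (⟨returnSet G P U, hmem⟩ : B)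
  have hW : IsClopen W := (StoneSpace.isClopen_basicOpen _).preimage a.continuous
  have h1 : z₁ ∈ W := by
    by_contra hcon
    obtain ⟨g, hgU, hgW⟩ := (hU.inter hW.compl.isOpen).exists_smul_mem G z₀ ⟨z₁, hzU, hcon⟩
    exact hgW ((hret _ g).2 (hopen U g hU hgU))
  have h2 : z₂ ∈ W := by
    have : a z₁ ∈ StoneSpace.basicOpen (⟨returnSet G P U, hmem⟩ : B) := h1
    rw [h12] at this
    exact this
  obtain ⟨g, hgV, hgW⟩ := (hV.inter hW.isOpen).exists_smul_mem G z₀ ⟨z₂, hzV, h2⟩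
  exact hdisj U V g hd ((hret _ g).1 hgW) (hopen V g hV hgV)

end ReturnAlgebra

/-! ### Universality -/

/-- Every boundary is a factor of the Stone space of a maximal algebra: a minimal joining of the
two is a boundary that maps bijectively onto the Stone space. -/
theorem IsBoundary.isFactor_stoneSpace {G : Type u} [Group G]
    {B : BooleanSubalgebra (Set G)} [IsTranslationInvariant B]
    (hB : Maximal (fun C : BooleanSubalgebra (Set G) =>
      IsTranslationInvariant C ∧
        ∀ A : Set G, A ∈ C → A.Nonempty → IsStronglyCompletelySyndetic A) B)
    {Y : Type v} [TopologicalSpace Y] [CompactSpace Y] [T2Space Y] [MulAction G Y]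
    [ContinuousConstSMul G Y] (hY : IsBoundary G Y) : IsFactor G Y (StoneSpace B) := by
  have hX : IsBoundary G (StoneSpace B) := StoneSpace.isBoundary hB.prop.2
  have := hX.nonempty
  have := hY.nonempty
  have := hX.isMinimal
  have := hY.isMinimal
  obtain ⟨M, hclosed, ⟨m, hm⟩, hmin⟩ := exists_minimal_subflow G (StoneSpace B × Y)
  have : CompactSpace M := isCompact_iff_compactSpace.1 hclosed.isCompact
  have : Nonempty M := ⟨⟨m, hm⟩⟩
  have : ContinuousConstSMul G M :=
    ⟨fun g => (continuous_subtype_val.const_smul g).subtype_mk _⟩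
  let a : C(M, StoneSpace B) := ⟨fun z => (z : StoneSpace B × Y).1, by fun_prop⟩
  let b : C(M, Y) := ⟨fun z => (z : StoneSpace B × Y).2, by fun_prop⟩
  have ha : ∀ (g : G) z, a (g • z) = g • a z := fun _ _ => rfl
  have hb : ∀ (g : G) z, b (g • z) = g • b z := fun _ _ => rfl
  have hM : IsBoundary G M := hX.of_joining hY a b ha hb fun z z' h h' =>
    Subtype.ext (Prod.ext h h')
  let e : M ≃ₜ StoneSpace B := a.continuous.homeoOfEquivCompactToT2
    (f := Equiv.ofBijective a ⟨injective_of_maximal hB hM a ha,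
      surjective_of_isMinimal G a.continuous ha⟩)
  have he : ∀ (g : G) x, e.symm (g • x) = g • e.symm x := fun g x => by
    rw [e.symm_apply_eq]
    change g • x = a (g • e.symm x)
    rw [ha]
    exact congrArg (g • ·) (e.apply_symm_apply x).symm
  exact ⟨fun x => b (e.symm x), b.continuous.comp e.symm.continuous,
    (surjective_of_isMinimal G b.continuous hb).comp e.symm.surjective, fun g x => by
      change b (e.symm (g • x)) = g • b (e.symm x)
      rw [he, hb]⟩

theorem mainTheorem2 (G : Type u) [Group G]
    (B : BooleanSubalgebra (Set G)) [IsTranslationInvariant B]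
    (hB : Maximal (fun C : BooleanSubalgebra (Set G) =>
      IsTranslationInvariant C ∧
        ∀ A : Set G, A ∈ C → A.Nonempty → IsStronglyCompletelySyndetic A) B) :
    IsUniversalMinimalStronglyProximal.{u, u, w} G (StoneSpace B) ∧
      ∀ (X : Type v) [TopologicalSpace X] [CompactSpace X] [T2Space X] [MulAction G X]
        [ContinuousConstSMul G X],
        IsUniversalMinimalStronglyProximal.{u, v, u} G X →
          FlowIsomorphic G X (StoneSpace B) := by
  have hS : IsBoundary G (StoneSpace B) := StoneSpace.isBoundary hB.prop.2
  refine ⟨⟨hS.isMinimalStronglyProximal, fun Y _ _ _ _ _ hY => hY.isBoundary.isFactor_stoneSpace hB⟩,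
    fun X _ _ _ _ _ hX => ?_⟩
  obtain ⟨α, hα, hαs, hαe⟩ := hX.universal (StoneSpace B) hS.isMinimalStronglyProximal
  obtain ⟨β, hβ, hβs, hβe⟩ := hX.isMinimalStronglyProximal.isBoundary.isFactor_stoneSpace hB
  -- The composition of the two factor maps is the identity, because boundaries are rigid.
  have hαβ : ∀ x, α (β x) = x := hS.eq_id (fun x => α (β x)) (hα.comp hβ) fun g x => by
    rw [hβe, hαe]
  have hβα : ∀ x, β (α x) = x := fun x => by
    obtain ⟨y, rfl⟩ := hβs x
    rw [hαβ]
  exact ⟨⟨⟨α, β, hβα, hαβ⟩, hα, hβ⟩, hαe⟩
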